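/- Theorem 5 (theorem:comparison). Fix a mass $N>0$ of users, a data plan with fee $F>0$ and data amount $Q>0$, a disutility $\Phi>0$ of watching one ad, a number $K\ge 1$ of advertisers, and advertising parameters $A\ge 0$, $B>0$. User types $\theta$ are uniformly distributed on $[0,\theta_{\max}]$ with $\theta_{\max}>\frac{(1+Q)F}{\ln(1+Q)}$, and the utility function is $u(z)=\ln(1+z)$. All expectations and masses below refer to this distribution. Users. Given a unit data reward $\omega\ge 0$, a type-$\theta$ user chooses a subscription decision $r\in\{0,1\}$ and a number of ads $x\in[0,\infty)$ maximizing $\theta u(Qr+\omega x)-Fr-\Phi x$; under the subscription-aware rewarding (SAR) scheme only subscribers may watch ads ($x=xr$), under the subscription-unaware rewarding (SUR) scheme there is no such constraint. A user indifferent between subscribing and not subscribing does not subscribe. Let $r^*(\theta,\omega),x^*(\theta,\omega)$ be the resulting decisions, and let $D(\omega)=N\,\mathbb E[Qr^*+\omega x^*]$ and $R^{\rm data}(\omega)=NF\,\mathbb E[r^*]$ be the total data demand and the data revenue. Advertisers. For the pool of ad slots created by a set of users watching ads, let $n$ be the mass of these users and $y$ the (random) number of ads watched by one of them, so that the pool has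 $\mathbb E[y]\,n$ slots. An advertiser buying $m\ge 0$ slots of the pool at price $p>0$ has payoff $n\,\mathbb E\Big[B\frac{my}{\mathbb E[y]n}-A\Big(\frac{my}{\mathbb E[y]n}\Big)^2\Big]-mp$ if $n>0$, and $-mp$ if $n=0$. A sale $(p,m)$ for the pool is feasible if $p>0$, $m$ maximizes this payoff over $[0,\infty)$, and $Km\le \mathbb E[y]\,n$; it brings the operator the revenue $Kmp$. Operator. Given a network capacity $C\ge D(0)$ (where $D(0)$ is the same under both schemes), the operator maximizes $R^{\rm data}(\omega)$ plus the ad revenue over $\omega\ge 0$ with $D(\omega)\le C$ and over feasible sales. Let $\Pi^{\rm SAR}(C)$ and $\Pi^{\rm SUR}(C)$ be the suprema under the SAR and the SUR scheme when all users watching ads form one pool, and let $\Pi^{\rm SURD}(C)$ be the supremum under the SUR scheme with differentiated ad slots, i.e. when the subscribers watching ads and the non-subscribers watching ads form two separate pools, each with its own price and its own feasible sale. Then these three suprema are finite for every $C\ge D(0)$; for all sufficiently large $C$, $$\Pi^{\rm SAR}(C)>\Pi^{\rm SURD}(C)\ge \Pi^{\rm SUR}(C);$$ and as $C\to\infty$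 the three revenues converge to finite limits satisfying $$\lim_{C\to\infty}\Pi^{\rm SAR}(C)>\lim_{C\to\infty}\Pi^{\rm SURD}(C)\ge\lim_{C\to\infty}\Pi^{\rm SUR}(C).$$ -/

import Mathlib

open MeasureTheory ProbabilityTheory Filter Topology

noncomputable section

/-- The primitives of the data-reward market. -/
structure Market where
  /-- mass of users -/
  N : ℝ
  /-- subscription fee of the data plan -/
  F : ℝ
  /-- data amount included in the data plan -/
  Q : ℝ
  /-- disutility of watching one ad -/
  Φ : ℝ
  /-- number of advertisers -/
  K : ℕ
  /-- degree of the wear-out effect -/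
  A : ℝ
  /-- linear coefficient of the advertising effectiveness -/
  B : ℝ
  /-- users' common utility function of data -/
  u : ℝ → ℝ
  /-- probability distribution of the users' types -/
  typeLaw : Measure ℝ

/-- The two rewarding schemes: subscription-aware (only subscribers may watch ads) and
subscription-unaware (everybody may watch ads). -/
inductive Scheme
  | SAR
  | SUR

namespace Market

variable (M : Market)

/-! ### Users -/

/-- Payoff of a type-`θ` user with subscription decision `r` who watches `x` ads under the
unit data reward `ω`. -/
def userPayoff (θ r x ω : ℝ) : ℝ :=
  θ * M.u (M.Q * r + ω * x) - M.F * r - M.Φ * x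

/-- The decisions `(r, x)` available to a user. -/
def userChoices : Scheme → Set (ℝ × ℝ)
  | .SAR => {d | (d.1 = 0 ∨ d.1 = 1) ∧ 0 ≤ d.2 ∧ d.2 = d.2 * d.1}
  | .SUR => {d | (d.1 = 0 ∨ d.1 = 1) ∧ 0 ≤ d.2}

/-- The payoff-maximizing decisions `(r, x)` of a type-`θ` user. -/
def userOptima (s : Scheme) (θ ω : ℝ) : Set (ℝ × ℝ) :=
  {d | d ∈ userChoices s ∧
    IsMaxOn (fun e : ℝ × ℝ => M.userPayoff θ e.1 e.2 ω) (userChoices s) d}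

/-- The decision `(r*, x*)` of a type-`θ` user: a payoff-maximizing one, where a user who is
indifferent between subscribing and not subscribing does not subscribe. -/
def userDecision (s : Scheme) (θ ω : ℝ) : ℝ × ℝ :=
  Classical.epsilon fun d : ℝ × ℝ =>
    d ∈ M.userOptima s θ ω ∧ ∀ e ∈ M.userOptima s θ ω, d.1 ≤ e.1

/-- The subscription decision `r*(θ, ω)`. -/
def subscription (s : Scheme) (θ ω : ℝ) : ℝ := (M.userDecision s θ ω).1

/-- The number `x*(θ, ω)` of watched ads. -/
def adsWatched (s : Scheme) (θ ω : ℝ) : ℝ := (M.userDecision s θ ω).2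

/-- The types that watch ads. -/
def watchers (s : Scheme) (ω : ℝ) : Set ℝ := {θ | 0 < M.adsWatched s θ ω}

/-- The types that watch ads and subscribe. -/
def subscribingWatchers (s : Scheme) (ω : ℝ) : Set ℝ :=
  {θ | 0 < M.adsWatched s θ ω ∧ M.subscription s θ ω = 1}

/-- The types that watch ads and do not subscribe. -/
def nonsubscribingWatchers (s : Scheme) (ω : ℝ) : Set ℝ :=
  {θ | 0 < M.adsWatched s θ ω ∧ M.subscription s θ ω = 0}

/-! ### Advertisers

The ad slots of a pool are those created by the types in a set `W`, where a user of type `θ`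
watches `x θ` ads. -/

/-- Mass of the users in `W`. -/
def adMass (W : Set ℝ) : ℝ := M.N * M.typeLaw.real W

/-- `𝔼[f y]`, where `y` is the number of ads watched by a random user given that its type
lies in `W`. -/
def adExpect (W : Set ℝ) (x : ℝ → ℝ) (f : ℝ → ℝ) : ℝ :=
  ∫ θ, f (x θ) ∂(ProbabilityTheory.cond M.typeLaw W)

/-- Total number of ad slots of the pool: `𝔼[y]` times the mass of its users. -/
def adSlots (W : Set ℝ) (x : ℝ → ℝ) : ℝ := M.adExpect W x (fun y => y) * M.adMass W

/-- Effectiveness, on a user who watches `y` ads, of the advertising of an advertiser who buys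
`m` slots of the pool. -/
def effectiveness (W : Set ℝ) (x : ℝ → ℝ) (m y : ℝ) : ℝ :=
  M.B * (m * y / M.adSlots W x) - M.A * (m * y / M.adSlots W x) ^ 2

open Classical in
/-- Payoff of an advertiser who buys `m` slots of the pool at the price `p`. -/
def advertiserPayoff (W : Set ℝ) (x : ℝ → ℝ) (m p : ℝ) : ℝ :=
  if M.adMass W = 0 then -(m * p)
  else M.adExpect W x (M.effectiveness W x m) * M.adMass W - m * p

/-- At the price `p` for the slots of the pool, `m` is an optimal purchase of each advertiser,
and the `K` advertisers together do not buy more slots than there are. -/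
def FeasibleSale (W : Set ℝ) (x : ℝ → ℝ) (p m : ℝ) : Prop :=
  0 < p ∧ 0 ≤ m ∧
    IsMaxOn (fun m' => M.advertiserPayoff W x m' p) (Set.Ici 0) m ∧
    M.K * m ≤ M.adSlots W x

/-! ### Operator -/

/-- Revenue from the data market. -/
def dataRevenue (s : Scheme) (ω : ℝ) : ℝ :=
  M.N * M.F * ∫ θ, M.subscription s θ ω ∂M.typeLaw

/-- Total data demand. -/
def dataDemand (s : Scheme) (ω : ℝ) : ℝ :=
  M.N * ∫ θ, (M.Q * M.subscription s θ ω + ω * M.adsWatched s θ ω) ∂M.typeLaw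

/-- The total revenues that the operator can attain under the scheme `s`, without
differentiation of ad slots, when the capacity is `C`. -/
def revenues (s : Scheme) (C : ℝ) : Set ℝ :=
  {R | ∃ ω p m : ℝ, 0 ≤ ω ∧ M.dataDemand s ω ≤ C ∧
    M.FeasibleSale (M.watchers s ω) (fun θ => M.adsWatched s θ ω) p m ∧
    R = M.dataRevenue s ω + M.K * m * p}

/-- The total revenues that the operator can attain under the SUR scheme, with the slots
generated by subscribers and by non-subscribers sold separately, when the capacity is `C`. -/
def revenuesDiff (C : ℝ) : Set ℝ :=
  {R | ∃ ω p₁ p₂ m₁ m₂ : ℝ, 0 ≤ ω ∧ M.dataDemand .SUR ω ≤ C ∧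
    M.FeasibleSale (M.subscribingWatchers .SUR ω) (fun θ => M.adsWatched .SUR θ ω) p₁ m₁ ∧
    M.FeasibleSale (M.nonsubscribingWatchers .SUR ω) (fun θ => M.adsWatched .SUR θ ω) p₂ m₂ ∧
    R = M.dataRevenue .SUR ω + M.K * m₁ * p₁ + M.K * m₂ * p₂}

/-- Optimal total revenue under the SAR scheme. -/
def optSAR (C : ℝ) : ℝ := sSup (M.revenues .SAR C)

/-- Optimal total revenue under the SUR scheme without differentiation. -/
def optSUR (C : ℝ) : ℝ := sSup (M.revenues .SUR C)

/-- Optimal total revenue under the SUR scheme with differentiation. -/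
def optSURD (C : ℝ) : ℝ := sSup (M.revenuesDiff C)

end Market

/-- The market with logarithmic utility and types uniform on `[0, θmax]`. -/
def logUniformMarket (N F Q Φ : ℝ) (K : ℕ) (A B θmax : ℝ) : Market where
  N := N
  F := F
  Q := Q
  Φ := Φ
  K := K
  A := A
  B := B
  u := fun z => Real.log (1 + z)
  typeLaw := ProbabilityTheory.cond volume (Set.Icc 0 θmax)

end

/-! An advertiser's payoff is a concave quadratic in the number of slots bought, so the first-order
condition fixes the price. Selling the fraction `μ` of a pool then earns `poolValue`, which depends
on the pool only through the first two moments of the ads watched and, for fixed `μ`, is additive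
over disjoint sets of users.

Under SUR a watcher of type `θ` sees `(θ - a) / Φ` ads, with `a` the threshold at which watching
starts; `a` depends on whether the user subscribes. The gain from subscribing is nondecreasing in
the type above the lower threshold and constant above the higher one. Hence each pool is, up to null
sets, an interval of types starting at its threshold, and the two intervals are disjoint. Over an
interval of relative length `l` the moments scale as `l²` and `l³`, so the pool is worth `l * V (l *
μ)` with `V = limitValue` (`exists_poolValue_SUR_eq`). As `l₁ + l₂ ≤ 1`, SUR advertising never earns
more than `g = max V` over `[0, 1]`. Moreover types up to `F / log (1 + Q)` never subscribe under
SUR (`dataRevenue_SUR_le`), so every SURD revenue stays below `N F + g` by a fixed amount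
(`revenuesDiff_le`).

Under SAR, as `ω → ∞`, every positive type subscribes and watches about `θ / Φ` ads, so the revenue
approaches `N F + g` (`tendsto_revenue_SAR`). Attainable sets grow with the capacity, so the optima
converge to the suprema over all capacities, where the gap is strict. SURD is at least SUR because
the same fraction can be sold in both pools. -/

noncomputable section

/-! ### The best number of ads for a given subscription decision -/

/-- The number of ads that maximizes `θ * log (1 + q + ω * x) - Φ * x` over `x ≥ 0`. -/
def logAds (Φ q ω θ : ℝ) : ℝ := if ω = 0 then 0 else max 0 (θ / Φ - (1 + q) / ω)

/-- The maximum of `θ * log (1 + q + ω * x) - Φ * x` over `x ≥ 0`. -/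
def logValue (Φ q ω θ : ℝ) : ℝ :=
  θ * Real.log (1 + q + ω * logAds Φ q ω θ) - Φ * logAds Φ q ω θ

lemma logAds_nonneg (Φ q ω θ : ℝ) : 0 ≤ logAds Φ q ω θ := by
  unfold logAds
  split_ifs <;> simp

lemma logAds_le {Φ q ω θ : ℝ} (hΦ : 0 < Φ) (hq : 0 ≤ q) (hω : 0 ≤ ω) (hθ : 0 ≤ θ) :
    logAds Φ q ω θ ≤ θ / Φ := by
  have h1 : 0 ≤ θ / Φ := by positivity
  have h2 : 0 ≤ (1 + q) / ω := by positivity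
  unfold logAds
  split_ifs
  · exact h1
  · exact max_le h1 (by linarith)

@[fun_prop]
lemma measurable_logAds (Φ q ω : ℝ) : Measurable (logAds Φ q ω) := by
  unfold logAds
  split_ifs <;> fun_prop

@[fun_prop]
lemma measurable_logValue (Φ q ω : ℝ) : Measurable (logValue Φ q ω) := by
  unfold logValue
  fun_prop

lemma logAds_of_pos {Φ q ω θ : ℝ} (hω : 0 < ω) :
    logAds Φ q ω θ = max 0 (θ / Φ - (1 + q) / ω) := by
  simp [logAds, hω.ne']

lemma logAds_pos_iff {Φ q ω θ : ℝ} (hΦ : 0 < Φ) (hω : 0 < ω) :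
    0 < logAds Φ q ω θ ↔ Φ * (1 + q) / ω < θ := by
  rw [logAds_of_pos hω, lt_max_iff]
  simp only [lt_self_iff_false, false_or, sub_pos]
  rw [lt_div_iff₀ hΦ]
  ring_nf

/-- The maximizer of the payoff from watching ads is unique. -/
lemma payoff_lt_logValue {Φ q ω θ x : ℝ} (hΦ : 0 < Φ) (hq : 0 ≤ q) (hω : 0 ≤ ω) (hx : 0 ≤ x)
    (hne : x ≠ logAds Φ q ω θ) :
    θ * Real.log (1 + q + ω * x) - Φ * x < logValue Φ q ω θ := by
  unfold logValue
  rcases hω.eq_or_lt with rfl | hω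
  · have : logAds Φ q 0 θ = 0 := by simp [logAds]
    rw [this] at hne ⊢
    have : 0 < x := lt_of_le_of_ne hx (Ne.symm hne)
    have := mul_pos hΦ this
    simp only [zero_mul, mul_zero]
    linarith
  set y := logAds Φ q ω θ with hy
  have hy0 : 0 ≤ y := logAds_nonneg _ _ _ _
  set z := 1 + q + ω * x with hz
  set w := 1 + q + ω * y with hw
  have hz1 : 1 + q ≤ z := by have := mul_nonneg hω.le hx; linarith
  have hw1 : 1 + q ≤ w := by have := mul_nonneg hω.le hy0; linarith
  have hzp : 0 < z := by linarith
  have hwp : 0 < w := by linarith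
  have hzw : z - w = ω * (x - y) := by rw [hz, hw]; ring
  -- Negative types carry no mass, but the decision is computed for every real `θ`.
  rcases le_or_gt θ 0 with hθ | hθ
  · have hyz : y = 0 := by
      rw [hy, logAds_of_pos hω]
      have h1 : θ / Φ ≤ 0 := div_nonpos_of_nonpos_of_nonneg hθ hΦ.le
      have h2 : 0 ≤ (1 + q) / ω := by positivity
      exact max_eq_left (by linarith)
    have hx0 : 0 < x := lt_of_le_of_ne hx (by rw [← hyz]; exact Ne.symm hne)
    have hwz : w ≤ z := by
      have : 0 ≤ ω * (x - y) := by rw [hyz]; positivity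
      linarith
    have h3 := mul_le_mul_of_nonpos_left (Real.log_le_log hwp hwz) hθ
    have h4 := mul_pos hΦ hx0
    rw [hyz]
    linarith
  -- Strict concavity of the logarithm: it lies below its tangent at `w`, strictly away from `w`.
  · have hlog : Real.log z - Real.log w < (z - w) / w := by
      rw [← Real.log_div hzp.ne' hwp.ne', sub_div, div_self hwp.ne']
      refine Real.log_lt_sub_one_of_pos (div_pos hzp hwp) ?_
      intro h
      have h5 : z - w = 0 := by
        rw [div_eq_one_iff_eq hwp.ne'] at h; linarith
      rw [hzw] at h5
      rcases mul_eq_zero.1 h5 with h6 | h6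
      · exact hω.ne' h6
      · exact hne (by linarith)
    have h1 : θ * (Real.log z - Real.log w) < θ * ((z - w) / w) :=
      mul_lt_mul_of_pos_left hlog hθ
    -- First-order condition at `y`: marginal utility `θ ω / w` is at most `Φ` at the corner `y = 0`
    -- and equals `Φ` in the interior.
    have h2 : θ * ((z - w) / w) ≤ Φ * (x - y) := by
      rw [hzw, ← mul_div_assoc, div_le_iff₀ hwp]
      rcases le_total (θ / Φ - (1 + q) / ω) 0 with hc | hc
      · have hyz : y = 0 := by rw [hy, logAds_of_pos hω]; exact max_eq_left hc
        have h7 : θ * ω ≤ Φ * w := by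
          rw [sub_nonpos, div_le_div_iff₀ hΦ hω] at hc
          nlinarith
        rw [hyz, sub_zero]
        nlinarith
      · have hyz : y = θ / Φ - (1 + q) / ω := by
          rw [hy, logAds_of_pos hω]; exact max_eq_right hc
        have h7 : Φ * w = θ * ω := by rw [hw, hyz]; field_simp; ring
        calc θ * (ω * (x - y)) = (θ * ω) * (x - y) := by ring
          _ ≤ Φ * (x - y) * w := by rw [← h7]; apply le_of_eq; ring
    linarith

/-! ### Users' decisions -/

namespace Market

variable {M : Market}

/-- A user who has a unique optimal number of ads for each subscription decision subscribes
if and only if this is strictly better than not subscribing. -/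
lemma userDecision_eq_ite {s : Scheme} {θ ω x₀ x₁ : ℝ}
    (h₀ : ((0 : ℝ), x₀) ∈ userChoices s) (h₁ : ((1 : ℝ), x₁) ∈ userChoices s)
    (u₀ : ∀ x, ((0 : ℝ), x) ∈ userChoices s → x ≠ x₀ →
      M.userPayoff θ 0 x ω < M.userPayoff θ 0 x₀ ω)
    (u₁ : ∀ x, ((1 : ℝ), x) ∈ userChoices s → x ≠ x₁ →
      M.userPayoff θ 1 x ω < M.userPayoff θ 1 x₁ ω) :
    M.userDecision s θ ω =
      if M.userPayoff θ 0 x₀ ω < M.userPayoff θ 1 x₁ ω then (1, x₁) else (0, x₀) := by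
  have hr : ∀ e ∈ userChoices s, e.1 = 0 ∨ e.1 = 1 := by
    intro e he
    cases s
    · exact he.1
    · exact he.1
  have le₀ : ∀ x, ((0 : ℝ), x) ∈ userChoices s →
      M.userPayoff θ 0 x ω ≤ M.userPayoff θ 0 x₀ ω := by
    intro x hx
    by_cases h : x = x₀
    · rw [h]
    · exact (u₀ x hx h).le
  have le₁ : ∀ x, ((1 : ℝ), x) ∈ userChoices s →
      M.userPayoff θ 1 x ω ≤ M.userPayoff θ 1 x₁ ω := by
    intro x hx
    by_cases h : x = x₁
    · rw [h]
    · exact (u₁ x hx h).le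
  set d : ℝ × ℝ := if M.userPayoff θ 0 x₀ ω < M.userPayoff θ 1 x₁ ω then (1, x₁) else (0, x₀)
    with hd
  -- Exactly one decision is optimal and survives the tie-breaking, so `Classical.epsilon` must
  -- return it.
  have key : ∀ e : ℝ × ℝ, (e ∈ M.userOptima s θ ω ∧ ∀ e' ∈ M.userOptima s θ ω, e.1 ≤ e'.1) ↔
      e = d := by
    by_cases hlt : M.userPayoff θ 0 x₀ ω < M.userPayoff θ 1 x₁ ω
    · rw [if_pos hlt] at hd
      have opt : ∀ e, e ∈ M.userOptima s θ ω ↔ e = d := by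
        rintro ⟨r, x⟩
        constructor
        · rintro ⟨hc, hm⟩
          have hm1 := hm h₁
          simp only [Set.mem_ofPred_eq] at hm1
          rcases hr _ hc with h | h <;> simp only at h <;> subst h
          · exact absurd (le₀ x hc) (by linarith)
          · rw [hd, Prod.mk.injEq]
            refine ⟨rfl, by_contra fun h => ?_⟩
            exact absurd (u₁ x hc h) (by linarith)
        · intro he
          rw [he, hd]
          refine ⟨h₁, ?_⟩
          rintro ⟨r', x'⟩ hc'
          simp only [Set.mem_ofPred_eq]
          rcases hr _ hc' with h | h <;> simp only at h <;> subst h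
          · exact (le₀ x' hc').trans hlt.le
          · exact le₁ x' hc'
      intro e
      simp only [opt]
      constructor
      · exact fun h => h.1
      · rintro rfl
        exact ⟨rfl, fun e' h => by rw [h]⟩
    · rw [if_neg hlt] at hd
      have hd_mem : d ∈ M.userOptima s θ ω := by
        rw [hd]
        refine ⟨h₀, ?_⟩
        rintro ⟨r', x'⟩ hc'
        simp only [Set.mem_ofPred_eq]
        rcases hr _ hc' with h | h <;> simp only at h <;> subst h
        · exact le₀ x' hc'
        · exact (le₁ x' hc').trans (not_lt.1 hlt)
      have hd1 : d.1 = 0 := by rw [hd]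
      rintro ⟨r, x⟩
      constructor
      · rintro ⟨⟨hc, hm⟩, hmin⟩
        have hle := hmin d hd_mem
        rw [hd1] at hle
        have hm1 := hm h₀
        simp only [Set.mem_ofPred_eq] at hm1
        rcases hr _ hc with h | h <;> simp only at h <;> subst h
        · rw [hd, Prod.mk.injEq]
          refine ⟨rfl, by_contra fun h => ?_⟩
          exact absurd (u₀ x hc h) (by linarith)
        · norm_num at hle
      · rintro he
        rw [he]
        refine ⟨hd_mem, fun e' he' => ?_⟩
        rw [hd1]
        rcases hr _ he'.1 with h | h <;> rw [h]
        norm_num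
  unfold userDecision
  have := Classical.epsilon_spec (p := fun e : ℝ × ℝ => e ∈ M.userOptima s θ ω ∧
    ∀ e' ∈ M.userOptima s θ ω, e.1 ≤ e'.1) ⟨d, (key d).2 rfl⟩
  exact (key _).1 this

/-- Utility of data is `log (1 + z)`, and the parameters of the users' problem have the
signs that it requires. -/
structure LogUsers (M : Market) : Prop where
  u_eq : M.u = fun z => Real.log (1 + z)
  F_pos : 0 < M.F
  Q_pos : 0 < M.Q
  Φ_pos : 0 < M.Φ

/-- The types that subscribe. -/
def subscribers (M : Market) (ω : ℝ) : Scheme → Set ℝ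
  | .SAR => {θ | 0 < logValue M.Φ M.Q ω θ - M.F}
  | .SUR => {θ | logValue M.Φ 0 ω θ < logValue M.Φ M.Q ω θ - M.F}

/-- The number of ads watched by a type that does not subscribe. -/
def outsideAds (M : Market) (ω : ℝ) : Scheme → ℝ → ℝ
  | .SAR => fun _ => 0
  | .SUR => logAds M.Φ 0 ω

lemma measurableSet_subscribers (M : Market) (ω : ℝ) (s : Scheme) :
    MeasurableSet (M.subscribers ω s) := by
  cases s
  · exact measurableSet_lt (by fun_prop) (by fun_prop)
  · exact measurableSet_lt (by fun_prop) (by fun_prop)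

lemma measurable_outsideAds (M : Market) (ω : ℝ) (s : Scheme) :
    Measurable (M.outsideAds ω s) := by
  cases s
  · exact measurable_const
  · exact measurable_logAds _ _ _

open Classical in
lemma LogUsers.userDecision_eq (h : M.LogUsers) (s : Scheme) {ω : ℝ} (hω : 0 ≤ ω) (θ : ℝ) :
    M.userDecision s θ ω = if θ ∈ M.subscribers ω s then (1, logAds M.Φ M.Q ω θ)
      else (0, M.outsideAds ω s θ) := by
  have p0 : ∀ x, M.userPayoff θ 0 x ω = θ * Real.log (1 + 0 + ω * x) - M.Φ * x := by
    intro x; simp [userPayoff, h.u_eq]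
  have p1 : ∀ x, M.userPayoff θ 1 x ω =
      θ * Real.log (1 + M.Q + ω * x) - M.Φ * x - M.F := by
    intro x; simp only [userPayoff, h.u_eq]; ring_nf
  have c1 : ∀ x, ((1 : ℝ), x) ∈ userChoices s ↔ 0 ≤ x := by
    intro x; cases s <;> simp [userChoices]
  have u1 : ∀ x, ((1 : ℝ), x) ∈ userChoices s → x ≠ logAds M.Φ M.Q ω θ →
      M.userPayoff θ 1 x ω < M.userPayoff θ 1 (logAds M.Φ M.Q ω θ) ω := by
    intro x hx hne
    rw [p1, p1]
    have := payoff_lt_logValue h.Φ_pos h.Q_pos.le hω ((c1 x).1 hx) hne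
    unfold logValue at this
    linarith
  cases s
  · have c0 : ∀ x, ((0 : ℝ), x) ∈ userChoices .SAR ↔ x = 0 := by
      intro x; simp +contextual [userChoices]
    rw [userDecision_eq_ite (M := M) (x₀ := 0) ((c0 0).2 rfl)
      ((c1 _).2 (logAds_nonneg M.Φ M.Q ω θ)) (fun x hx hne => absurd ((c0 x).1 hx) hne) u1,
      p0, p1]
    simp [subscribers, outsideAds, logValue]
  · have c0 : ∀ x, ((0 : ℝ), x) ∈ userChoices .SUR ↔ 0 ≤ x := by
      intro x; simp [userChoices]
    rw [userDecision_eq_ite (M := M) ((c0 _).2 (logAds_nonneg M.Φ 0 ω θ))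
      ((c1 _).2 (logAds_nonneg M.Φ M.Q ω θ)) (fun x hx hne => ?_) u1,
      p0, p1]
    · simp only [subscribers, outsideAds, logValue, Set.mem_ofPred_eq]
      congr
    · rw [p0, p0]
      exact payoff_lt_logValue h.Φ_pos le_rfl hω ((c0 x).1 hx) hne

lemma LogUsers.subscription_eq (h : M.LogUsers) (s : Scheme) {ω : ℝ} (hω : 0 ≤ ω) :
    (fun θ => M.subscription s θ ω) = (M.subscribers ω s).indicator 1 := by
  classical
  ext θ
  rw [subscription, h.userDecision_eq s hω, Set.indicator_apply]
  split_ifs <;> rfl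

open Classical in
lemma LogUsers.adsWatched_eq (h : M.LogUsers) (s : Scheme) {ω : ℝ} (hω : 0 ≤ ω) :
    (fun θ => M.adsWatched s θ ω) =
      (M.subscribers ω s).piecewise (logAds M.Φ M.Q ω) (M.outsideAds ω s) := by
  ext θ
  rw [adsWatched, h.userDecision_eq s hω, Set.piecewise]
  split_ifs <;> rfl

lemma LogUsers.measurable_adsWatched (h : M.LogUsers) (s : Scheme) {ω : ℝ} (hω : 0 ≤ ω) :
    Measurable fun θ => M.adsWatched s θ ω := by
  classical
  rw [h.adsWatched_eq s hω]
  exact (measurable_logAds _ _ _).piecewise (M.measurableSet_subscribers ω s)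
    (M.measurable_outsideAds ω s)

lemma LogUsers.adsWatched_nonneg (h : M.LogUsers) (s : Scheme) {ω : ℝ} (hω : 0 ≤ ω) (θ : ℝ) :
    0 ≤ M.adsWatched s θ ω := by
  classical
  rw [congrFun (h.adsWatched_eq s hω) θ, Set.piecewise]
  split_ifs
  · exact logAds_nonneg _ _ _ _
  · cases s
    · exact le_rfl
    · exact logAds_nonneg _ _ _ _

lemma LogUsers.adsWatched_le (h : M.LogUsers) (s : Scheme) {ω θ : ℝ} (hω : 0 ≤ ω) (hθ : 0 ≤ θ) :
    M.adsWatched s θ ω ≤ θ / M.Φ := by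
  classical
  rw [congrFun (h.adsWatched_eq s hω) θ, Set.piecewise]
  split_ifs
  · exact logAds_le h.Φ_pos h.Q_pos.le hω hθ
  · cases s
    · exact div_nonneg hθ h.Φ_pos.le
    · exact logAds_le h.Φ_pos le_rfl hω hθ

lemma LogUsers.measurableSet_watchers (h : M.LogUsers) (s : Scheme) {ω : ℝ} (hω : 0 ≤ ω) :
    MeasurableSet (M.watchers s ω) :=
  measurableSet_lt measurable_const (h.measurable_adsWatched s hω)

lemma LogUsers.subscription_eq_one_iff (h : M.LogUsers) (s : Scheme) {ω : ℝ} (hω : 0 ≤ ω)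
    (θ : ℝ) : M.subscription s θ ω = 1 ↔ θ ∈ M.subscribers ω s := by
  classical
  rw [congrFun (h.subscription_eq s hω) θ, Set.indicator_apply]
  split_ifs with hs <;> simp [hs]

lemma LogUsers.subscription_eq_zero_iff (h : M.LogUsers) (s : Scheme) {ω : ℝ} (hω : 0 ≤ ω)
    (θ : ℝ) : M.subscription s θ ω = 0 ↔ θ ∉ M.subscribers ω s := by
  classical
  rw [congrFun (h.subscription_eq s hω) θ, Set.indicator_apply]
  split_ifs with hs <;> simp [hs]

lemma LogUsers.subscribingWatchers_eq (h : M.LogUsers) (s : Scheme) {ω : ℝ} (hω : 0 ≤ ω) :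
    M.subscribingWatchers s ω = M.watchers s ω ∩ M.subscribers ω s := by
  ext θ
  simp only [subscribingWatchers, watchers, Set.mem_ofPred_eq, Set.mem_inter_iff,
    h.subscription_eq_one_iff s hω]

lemma LogUsers.nonsubscribingWatchers_eq (h : M.LogUsers) (s : Scheme) {ω : ℝ} (hω : 0 ≤ ω) :
    M.nonsubscribingWatchers s ω = M.watchers s ω \ M.subscribers ω s := by
  ext θ
  simp only [nonsubscribingWatchers, watchers, Set.mem_ofPred_eq, Set.mem_sdiff,
    h.subscription_eq_zero_iff s hω]

end Market

/-! ### Advertisers: the revenue from a pool -/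

namespace Market

variable {M : Market}

/-- The revenue from a pool when the fraction `μ` of its slots is sold at the highest price at
which the advertisers buy them. -/
def poolValue (M : Market) (W : Set ℝ) (x : ℝ → ℝ) (μ : ℝ) : ℝ :=
  μ * (M.B * (M.N * ∫ θ in W, x θ ∂M.typeLaw)) -
    μ ^ 2 * (2 * M.A / M.K * (M.N * ∫ θ in W, x θ ^ 2 ∂M.typeLaw))

/-- The parameters of the advertisers' problem have the signs that it requires, and the types
follow a probability distribution. -/
structure AdMarket (M : Market) : Prop where
  N_pos : 0 < M.N
  A_nonneg : 0 ≤ M.A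
  B_pos : 0 < M.B
  K_pos : 0 < M.K
  isProbabilityMeasure : IsProbabilityMeasure M.typeLaw

/-- A pool with finite second moment: every user in `W` watches ads. -/
structure Pool (M : Market) (W : Set ℝ) (x : ℝ → ℝ) : Prop where
  measurableSet : MeasurableSet W
  pos : ∀ θ ∈ W, 0 < x θ
  integrable : IntegrableOn x W M.typeLaw
  integrable_sq : IntegrableOn (fun θ => x θ ^ 2) W M.typeLaw

variable {W : Set ℝ} {x : ℝ → ℝ}

lemma adExpect_mul_adMass (hM : M.AdMarket) (hm : M.typeLaw.real W ≠ 0) (f : ℝ → ℝ) :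
    M.adExpect W x f * M.adMass W = M.N * ∫ θ in W, f (x θ) ∂M.typeLaw := by
  have := hM.isProbabilityMeasure
  rw [adExpect, adMass, ProbabilityTheory.cond, integral_smul_measure, ENNReal.toReal_inv,
    smul_eq_mul]
  change (M.typeLaw.real W)⁻¹ * _ * _ = _
  field_simp

lemma adMass_eq_zero_iff (hM : M.AdMarket) : M.adMass W = 0 ↔ M.typeLaw.real W = 0 := by
  simp [adMass, hM.N_pos.ne']

lemma setIntegral_eq_zero_of_real_eq_zero (hM : M.AdMarket) (h : M.typeLaw.real W = 0)
    (f : ℝ → ℝ) : ∫ θ in W, f θ ∂M.typeLaw = 0 := by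
  have := hM.isProbabilityMeasure
  rw [measureReal_eq_zero_iff] at h
  rw [Measure.restrict_eq_zero.2 h, integral_zero_measure]

lemma adSlots_eq (hM : M.AdMarket) : M.adSlots W x = M.N * ∫ θ in W, x θ ∂M.typeLaw := by
  by_cases hm : M.typeLaw.real W = 0
  · rw [adSlots, (adMass_eq_zero_iff hM).2 hm, setIntegral_eq_zero_of_real_eq_zero hM hm]
    simp
  · rw [adSlots, adExpect_mul_adMass hM hm]

lemma Pool.setIntegral_pos (hM : M.AdMarket) (hW : M.Pool W x) (h : M.typeLaw.real W ≠ 0) :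
    0 < ∫ θ in W, x θ ∂M.typeLaw := by
  have := hM.isProbabilityMeasure
  rw [setIntegral_pos_iff_support_of_nonneg_ae _ hW.integrable]
  · rw [Set.inter_eq_right.2 (show W ⊆ Function.support x from fun θ hθ => (hW.pos θ hθ).ne'),
      pos_iff_ne_zero]
    intro h0
    exact h (by rw [measureReal_def, h0, ENNReal.toReal_zero])
  · exact (ae_restrict_iff' hW.measurableSet).2 (ae_of_all _ fun θ hθ => (hW.pos θ hθ).le)

/-- Effectiveness is quadratic in the ads watched, so the type distribution enters only through two
moments, and the payoff is concave in `m`. -/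
lemma Pool.advertiserPayoff_eq (hM : M.AdMarket) (hW : M.Pool W x)
    (h : M.typeLaw.real W ≠ 0) (m p : ℝ) :
    M.advertiserPayoff W x m p = (M.B - p) * m -
      M.A * (M.N * ∫ θ in W, x θ ^ 2 ∂M.typeLaw) / (M.N * ∫ θ in W, x θ ∂M.typeLaw) ^ 2
        * m ^ 2 := by
  have hX := mul_pos hM.N_pos (hW.setIntegral_pos hM h)
  rw [advertiserPayoff, if_neg (by rwa [adMass_eq_zero_iff hM]), adExpect_mul_adMass hM h]
  have hN := hM.N_pos
  have hX' := hW.setIntegral_pos hM h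
  have e : ∀ θ, M.effectiveness W x m (x θ) =
      M.B * m / (M.N * ∫ θ in W, x θ ∂M.typeLaw) * x θ -
        M.A * m ^ 2 / (M.N * ∫ θ in W, x θ ∂M.typeLaw) ^ 2 * x θ ^ 2 := by
    intro θ
    rw [effectiveness, adSlots_eq hM]
    ring
  simp_rw [e]
  rw [integral_sub (hW.integrable.const_mul _) (hW.integrable_sq.const_mul _),
    integral_const_mul, integral_const_mul]
  field_simp
  ring

/-- At least the value of a pool can be attained by a feasible sale. -/
lemma Pool.exists_feasibleSale (hM : M.AdMarket) (hW : M.Pool W x) {μ : ℝ}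
    (hμ : μ ∈ Set.Icc (0 : ℝ) 1) :
    ∃ p m, M.FeasibleSale W x p m ∧ M.poolValue W x μ ≤ M.K * m * p := by
  have hK : (0 : ℝ) < M.K := Nat.cast_pos.2 hM.K_pos
  by_cases h : M.typeLaw.real W = 0
  · refine ⟨1, 0, ⟨one_pos, le_rfl, ?_, ?_⟩, ?_⟩
    · intro m hm
      rw [Set.mem_Ici] at hm
      simp only [Set.mem_ofPred_eq, advertiserPayoff, (adMass_eq_zero_iff hM).2 h, if_true]
      linarith
    · rw [adSlots_eq hM, setIntegral_eq_zero_of_real_eq_zero hM h]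
      simp
    · rw [poolValue, setIntegral_eq_zero_of_real_eq_zero hM h,
        setIntegral_eq_zero_of_real_eq_zero hM h]
      simp
  have hpay := hW.advertiserPayoff_eq hM h
  have hX := mul_pos hM.N_pos (hW.setIntegral_pos hM h)
  have hY : 0 ≤ M.A * (M.N * ∫ θ in W, x θ ^ 2 ∂M.typeLaw) :=
    mul_nonneg hM.A_nonneg (mul_nonneg hM.N_pos.le (integral_nonneg fun θ => sq_nonneg _))
  unfold poolValue
  have hs := adSlots_eq (W := W) (x := x) hM
  set X := M.N * ∫ θ in W, x θ ∂M.typeLaw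
  set Y := M.N * ∫ θ in W, x θ ^ 2 ∂M.typeLaw
  set c := M.A * Y / X ^ 2 with hc
  have hc0 : 0 ≤ c := by positivity
  -- When the value is not positive, the first-order price need not be positive either. Selling
  -- nothing at price `B` is feasible and does at least as well.
  rcases le_or_gt (μ * (M.B * X) - μ ^ 2 * (2 * M.A / M.K * Y)) 0 with hv | hv
  · refine ⟨M.B, 0, ⟨hM.B_pos, le_rfl, ?_, ?_⟩, by simpa using hv⟩
    · intro m hm
      simp only [Set.mem_ofPred_eq, hpay]
      have := mul_nonneg hc0 (sq_nonneg m)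
      linarith
    · rw [hs]; simpa using hX.le
  · have hval : M.K * (μ * X / M.K) * (M.B - 2 * c * (μ * X / M.K)) =
        μ * (M.B * X) - μ ^ 2 * (2 * M.A / M.K * Y) := by
      rw [hc]; field_simp
    have hm0 : 0 ≤ μ * X / M.K := by have := hμ.1; positivity
    -- Each advertiser takes a `K`-th of the sold slots, at the price that makes this its
    -- first-order condition. Optimality follows by completing the square.
    refine ⟨M.B - 2 * c * (μ * X / M.K), μ * X / M.K, ⟨?_, hm0, ?_, ?_⟩, hval.ge⟩
    · rw [← hval] at hv
      exact pos_of_mul_pos_right hv (by positivity)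
    · intro m hm
      simp only [Set.mem_ofPred_eq, hpay]
      have := mul_nonneg hc0 (sq_nonneg (m - μ * X / M.K))
      linarith
    · rw [hs, mul_div_cancel₀ _ hK.ne']
      nlinarith [hμ.2]

/-- The revenue of a feasible sale is the value of the pool for some fraction of its slots. -/
lemma FeasibleSale.exists_poolValue_eq (hM : M.AdMarket) (hW : M.Pool W x) {p m : ℝ}
    (hs : M.FeasibleSale W x p m) :
    ∃ μ ∈ Set.Icc (0 : ℝ) 1, M.K * m * p = M.poolValue W x μ := by
  have hK : (0 : ℝ) < M.K := Nat.cast_pos.2 hM.K_pos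
  obtain ⟨hp, hm, hmax, hcap⟩ := hs
  -- At `m = 0` the maximum is on the boundary and the price is not determined, but the revenue is
  -- zero.
  rcases hm.eq_or_lt with rfl | hm
  · exact ⟨0, by simp, by simp [poolValue]⟩
  have h : M.typeLaw.real W ≠ 0 := by
    intro h
    have := hmax (Set.self_mem_Ici (a := (0 : ℝ)))
    simp only [Set.mem_ofPred_eq, advertiserPayoff, (adMass_eq_zero_iff hM).2 h, if_true] at this
    have := mul_pos hm hp
    linarith
  have hpay := hW.advertiserPayoff_eq hM h
  have hX := mul_pos hM.N_pos (hW.setIntegral_pos hM h)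
  unfold poolValue
  rw [adSlots_eq hM] at hcap
  set X := M.N * ∫ θ in W, x θ ∂M.typeLaw
  set Y := M.N * ∫ θ in W, x θ ^ 2 ∂M.typeLaw
  have hloc := hmax.isLocalMax (Ici_mem_nhds hm)
  simp only [hpay] at hloc
  have hd := hloc.hasDerivAt_eq_zero (((hasDerivAt_id m).const_mul (M.B - p)).sub
    ((hasDerivAt_pow 2 m).const_mul (M.A * Y / X ^ 2)))
  have hp' : p = M.B - 2 * (M.A * Y / X ^ 2) * m := by
    norm_num at hd
    linarith
  refine ⟨M.K * m / X, ⟨by positivity, (div_le_one hX).2 hcap⟩, ?_⟩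
  rw [hp']
  field_simp

/-- The value of a pool is additive in its set of users. -/
lemma poolValue_inter_add_sdiff (hW : M.Pool W x) {S : Set ℝ} (hS : MeasurableSet S) (μ : ℝ) :
    M.poolValue (W ∩ S) x μ + M.poolValue (W \ S) x μ = M.poolValue W x μ := by
  unfold poolValue
  rw [← integral_inter_add_sdiff hS hW.integrable, ← integral_inter_add_sdiff hS hW.integrable_sq]
  ring

lemma Pool.inter (hW : M.Pool W x) {S : Set ℝ} (hS : MeasurableSet S) : M.Pool (W ∩ S) x where
  measurableSet := hW.measurableSet.inter hS
  pos θ hθ := hW.pos θ hθ.1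
  integrable := hW.integrable.mono_set Set.inter_subset_left
  integrable_sq := hW.integrable_sq.mono_set Set.inter_subset_left

lemma Pool.sdiff (hW : M.Pool W x) {S : Set ℝ} (hS : MeasurableSet S) : M.Pool (W \ S) x :=
  hW.inter hS.compl

end Market

/-! ### The gain from subscribing, and large unit rewards -/

/-- A type that watches ads as a subscriber gains the monetary value of the data in the plan. -/
lemma logValue_sub_eq {Φ q ω θ : ℝ} (hΦ : 0 < Φ) (hq : 0 < q) (hω : 0 < ω)
    (hθ : Φ * (1 + q) / ω ≤ θ) :
    logValue Φ q ω θ - logValue Φ 0 ω θ = Φ * q / ω := by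
  have h1 : Φ * (1 + 0) / ω ≤ θ := le_trans (by gcongr) hθ
  have e : ∀ q, 0 ≤ q → Φ * (1 + q) / ω ≤ θ → logAds Φ q ω θ = θ / Φ - (1 + q) / ω := by
    intro q _ h
    rw [logAds_of_pos hω, max_eq_right]
    rw [sub_nonneg, le_div_iff₀ hΦ]
    linarith [show (1 + q) / ω * Φ = Φ * (1 + q) / ω by ring]
  unfold logValue
  rw [e q hq.le hθ, e 0 le_rfl h1]
  have z : ∀ q, 1 + q + ω * (θ / Φ - (1 + q) / ω) = ω * θ / Φ := by
    intro q; field_simp; ring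
  rw [z, z]
  field_simp
  ring

/-- The gain from subscribing is monotone in the type as soon as the type would watch ads
without subscribing. -/
lemma logValue_sub_mono {Φ q ω θ θ' : ℝ} (hΦ : 0 < Φ) (hq : 0 < q) (hω : 0 < ω)
    (hθ : Φ / ω < θ) (hle : θ ≤ θ') :
    logValue Φ q ω θ - logValue Φ 0 ω θ ≤ logValue Φ q ω θ' - logValue Φ 0 ω θ' := by
  have low : ∀ t, Φ / ω < t → t ≤ Φ * (1 + q) / ω → logValue Φ q ω t - logValue Φ 0 ω t =
      t * (Real.log (1 + q) - Real.log (ω * t / Φ) + 1) - Φ / ω := by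
    intro t h1 h2
    have e1 : logAds Φ q ω t = 0 :=
      le_antisymm (not_lt.1 fun h => h2.not_gt ((logAds_pos_iff hΦ hω).1 h)) (logAds_nonneg _ _ _ _)
    have e0 : logAds Φ 0 ω t = t / Φ - 1 / ω := by
      rw [logAds_of_pos hω, add_zero, max_eq_right]
      rw [sub_nonneg, le_div_iff₀ hΦ]
      linarith [show 1 / ω * Φ = Φ / ω by ring]
    have z : 1 + 0 + ω * (t / Φ - 1 / ω) = ω * t / Φ := by field_simp; ring
    unfold logValue
    rw [e1, e0, z, mul_zero, add_zero]
    field_simp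
    ring
  have mono : ∀ s t, Φ / ω < s → s ≤ t → t ≤ Φ * (1 + q) / ω →
      logValue Φ q ω s - logValue Φ 0 ω s ≤ logValue Φ q ω t - logValue Φ 0 ω t := by
    intro s t h1 h2 h3
    rw [low s h1 (h2.trans h3), low t (h1.trans_le h2) h3]
    have hs : 0 < s := lt_trans (by positivity) h1
    have ht : 0 < t := hs.trans_le h2
    have k1 : Real.log (ω * t / Φ) - Real.log (ω * s / Φ) ≤ t / s - 1 := by
      rw [← Real.log_div (by positivity) (by positivity)]
      refine (Real.log_le_sub_one_of_pos (by positivity)).trans_eq ?_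
      field_simp
    have k2 : s * (Real.log (ω * t / Φ) - Real.log (ω * s / Φ)) ≤ t - s := by
      refine (mul_le_mul_of_nonneg_left k1 hs.le).trans_eq ?_
      field_simp
    have k3 : Real.log (ω * t / Φ) ≤ Real.log (1 + q) := by
      apply Real.log_le_log (by positivity)
      rw [le_div_iff₀ hω] at h3
      rw [div_le_iff₀ hΦ]
      linarith
    -- The increment of the gain from `s` to `t` is `(t - s) * (log (1 + q) - log (ω t / Φ))` plus
    -- the slack in `k2`.
    have k4 := mul_nonneg (sub_nonneg.2 h2) (sub_nonneg.2 k3)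
    linarith
  rcases le_total θ' (Φ * (1 + q) / ω) with h1 | h1
  · exact mono θ θ' hθ hle h1
  rw [logValue_sub_eq hΦ hq hω h1]
  rcases le_total θ (Φ * (1 + q) / ω) with h2 | h2
  · have := mono θ _ hθ h2 le_rfl
    rwa [logValue_sub_eq hΦ hq hω le_rfl] at this
  · rw [logValue_sub_eq hΦ hq hω h2]

/-- A non-subscriber can copy the subscriber's ads. Since `1 + q + ω x ≤ (1 + q) * (1 + ω x)`, this
loses at most `θ * log (1 + q)`. -/
lemma logValue_sub_le {Φ q ω θ : ℝ} (hΦ : 0 < Φ) (hq : 0 ≤ q) (hω : 0 ≤ ω) (hθ : 0 ≤ θ) :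
    logValue Φ q ω θ - logValue Φ 0 ω θ ≤ θ * Real.log (1 + q) := by
  set x := logAds Φ q ω θ with hx
  have hx0 : 0 ≤ x := logAds_nonneg _ _ _ _
  have h0 : θ * Real.log (1 + 0 + ω * x) - Φ * x ≤ logValue Φ 0 ω θ := by
    by_cases h : x = logAds Φ 0 ω θ
    · rw [h]; exact le_rfl
    · exact (payoff_lt_logValue hΦ le_rfl hω hx0 h).le
  have hωx : 0 ≤ ω * x := mul_nonneg hω hx0
  have h1 : Real.log (1 + q + ω * x) ≤ Real.log (1 + q) + Real.log (1 + 0 + ω * x) := by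
    rw [← Real.log_mul (by linarith) (by linarith)]
    apply Real.log_le_log (by linarith)
    nlinarith [mul_nonneg hq hωx]
  have h2 := mul_le_mul_of_nonneg_left h1 hθ
  have h3 : logValue Φ q ω θ = θ * Real.log (1 + q + ω * x) - Φ * x := rfl
  linarith

/-- Watching a single ad already yields an unbounded payoff as `ω` grows. -/
lemma tendsto_logValue {Φ q θ : ℝ} (hΦ : 0 < Φ) (hq : 0 ≤ q) (hθ : 0 < θ) :
    Tendsto (fun ω => logValue Φ q ω θ) atTop atTop := by
  have h : Tendsto (fun ω => θ * Real.log (1 + q + ω * 1) - Φ * 1) atTop atTop := by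
    refine tendsto_atTop_add_const_right _ (-(Φ * 1))
      (Tendsto.const_mul_atTop hθ (Real.tendsto_log_atTop.comp ?_))
    simpa using tendsto_atTop_add_const_left atTop (1 + q) tendsto_id
  refine tendsto_atTop_mono' _ ?_ h
  filter_upwards [eventually_ge_atTop 0] with ω hω
  by_cases he : 1 = logAds Φ q ω θ
  · unfold logValue; rw [← he]
  · exact (payoff_lt_logValue hΦ hq hω zero_le_one he).le

lemma tendsto_logAds {Φ q θ : ℝ} (hΦ : 0 < Φ) (hθ : 0 < θ) :
    Tendsto (fun ω => logAds Φ q ω θ) atTop (𝓝 (θ / Φ)) := by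
  have h : Tendsto (fun ω => max 0 (θ / Φ - (1 + q) / ω)) atTop (𝓝 (max 0 (θ / Φ - 0))) :=
    tendsto_const_nhds.max (tendsto_const_nhds.sub (tendsto_const_nhds.div_atTop tendsto_id))
  rw [sub_zero, max_eq_right (div_nonneg hθ.le hΦ.le)] at h
  refine h.congr' ?_
  filter_upwards [eventually_gt_atTop 0] with ω hω
  rw [logAds_of_pos hω]

/-- An initial segment of `(a, ∞)` meets `[0, T]` in an interval, up to null sets. -/
lemma exists_inter_Icc_ae_eq_Ioc {W : Set ℝ} {a T : ℝ} (ha : 0 ≤ a) (hW : W ⊆ Set.Ioi a)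
    (hlow : ∀ θ ∈ Set.Ioi a, ∀ θ' ∈ W, θ ≤ θ' → θ ∈ W) :
    ∃ b, a ≤ b ∧ (W ∩ Set.Icc 0 T : Set ℝ) =ᵐ[volume] Set.Ioc a b ∧
      ∀ c, a ≤ c → (∀ θ ∈ W, θ ≤ T → θ ≤ c) → b ≤ c := by
  -- Inserting `a` keeps the set nonempty: an empty intersection gives `b = a`.
  set S := insert a (W ∩ Set.Icc 0 T) with hS
  have hbdd : BddAbove S := by
    refine ⟨max a T, ?_⟩
    rintro θ (rfl | ⟨-, -, h⟩)
    · exact le_max_left _ _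
    · exact h.trans (le_max_right _ _)
  have haS : a ∈ S := Set.mem_insert _ _
  refine ⟨sSup S, le_csSup hbdd haS, ?_, ?_⟩
  · have h1 : Set.Ioo a (sSup S) ⊆ W ∩ Set.Icc 0 T := by
      rintro θ ⟨h1, h2⟩
      obtain ⟨w, hw, hlt⟩ := exists_lt_of_lt_csSup ⟨a, haS⟩ h2
      rcases hw with rfl | ⟨hw, -, hwT⟩
      · exact absurd h1 hlt.not_gt
      · exact ⟨hlow θ h1 w hw hlt.le, ha.trans h1.le, hlt.le.trans hwT⟩
    have h2 : W ∩ Set.Icc 0 T ⊆ Set.Ioc a (sSup S) := fun θ hθ =>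
      ⟨hW hθ.1, le_csSup hbdd (Set.mem_insert_of_mem _ hθ)⟩
    exact (LE.le.eventuallyLE h2).antisymm
      (Ioo_ae_eq_Ioc.symm.le.trans (LE.le.eventuallyLE h1))
  · intro c hc h
    refine csSup_le ⟨a, haS⟩ ?_
    rintro θ (rfl | ⟨h1, -, h2⟩)
    · exact hc
    · exact h θ h1 h2

/-! ### Uniform types: data revenue and pool values -/

namespace Market

variable {M : Market} {T : ℝ}

/-- A market with logarithmic utility and types uniform on `[0, T]`. -/
structure LogUniform (M : Market) (T : ℝ) : Prop extends LogUsers M, AdMarket M where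
  T_pos : 0 < T
  typeLaw_eq : M.typeLaw = ProbabilityTheory.cond volume (Set.Icc 0 T)

lemma LogUniform.setIntegral_eq (h : M.LogUniform T) {W : Set ℝ} (hW : MeasurableSet W)
    (f : ℝ → ℝ) : ∫ θ in W, f θ ∂M.typeLaw = T⁻¹ * ∫ θ in W ∩ Set.Icc 0 T, f θ := by
  rw [h.typeLaw_eq, ProbabilityTheory.cond, Measure.restrict_smul, Measure.restrict_restrict hW,
    integral_smul_measure, ENNReal.toReal_inv, Real.volume_Icc,
    ENNReal.toReal_ofReal (by linarith [h.T_pos]), smul_eq_mul, sub_zero]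

lemma LogUniform.ae_mem (h : M.LogUniform T) : ∀ᵐ θ ∂M.typeLaw, θ ∈ Set.Ioc 0 T := by
  rw [h.typeLaw_eq]
  have : ∀ᵐ θ ∂(volume.restrict (Set.Icc 0 T)), θ ∈ Set.Ioc 0 T := by
    rw [← restrict_Ioc_eq_restrict_Icc]
    exact ae_restrict_mem measurableSet_Ioc
  exact Measure.ae_smul_measure this _

/-- The value of the pool in which each type `θ` watches `θ / Φ` ads: the limit for large unit
rewards. -/
def limitValue (M : Market) (μ : ℝ) : ℝ := M.poolValue Set.univ (fun θ => θ / M.Φ) μ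

lemma integral_Ioc_sub_div {a b Φ : ℝ} (hab : a ≤ b) :
    ∫ θ in Set.Ioc a b, (θ - a) / Φ = (b - a) ^ 2 / (2 * Φ) := by
  rw [← intervalIntegral.integral_of_le hab,
    intervalIntegral.integral_comp_sub_right (fun θ => θ / Φ) a,
    intervalIntegral.integral_div, integral_id]
  ring

lemma integral_Ioc_sub_div_sq {a b Φ : ℝ} (hab : a ≤ b) :
    ∫ θ in Set.Ioc a b, ((θ - a) / Φ) ^ 2 = (b - a) ^ 3 / (3 * Φ ^ 2) := by
  simp_rw [div_pow]
  rw [← intervalIntegral.integral_of_le hab,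
    intervalIntegral.integral_comp_sub_right (fun θ => θ ^ 2 / Φ ^ 2) a,
    intervalIntegral.integral_div, integral_pow]
  norm_num
  ring

/-- The value of a pool whose users' types form an interval of length `l`, the lowest of them
watching no ads, is a rescaling of the limit value. -/
lemma LogUniform.poolValue_eq (h : M.LogUniform T) {W : Set ℝ} (hW : MeasurableSet W)
    {a b : ℝ} (hab : a ≤ b) (hI : (W ∩ Set.Icc 0 T : Set ℝ) =ᵐ[volume] Set.Ioc a b)
    {x : ℝ → ℝ} (hx : ∀ θ ∈ W, x θ = (θ - a) / M.Φ) (μ : ℝ) :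
    M.poolValue W x μ = (b - a) / T * M.limitValue ((b - a) / T * μ) := by
  have hT := h.T_pos
  have hΦ := h.Φ_pos
  have e1 : ∫ θ in W, x θ ∂M.typeLaw = T⁻¹ * ((b - a) ^ 2 / (2 * M.Φ)) := by
    rw [setIntegral_congr_fun hW hx, h.setIntegral_eq hW, setIntegral_congr_set hI,
      integral_Ioc_sub_div hab]
  have e2 : ∫ θ in W, x θ ^ 2 ∂M.typeLaw = T⁻¹ * ((b - a) ^ 3 / (3 * M.Φ ^ 2)) := by
    rw [setIntegral_congr_fun hW (g := fun θ => ((θ - a) / M.Φ) ^ 2)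
      (fun θ hθ => by simp only [hx θ hθ]), h.setIntegral_eq hW,
      setIntegral_congr_set hI, integral_Ioc_sub_div_sq hab]
  have hI0 : (Set.univ ∩ Set.Icc 0 T : Set ℝ) =ᵐ[volume] Set.Ioc 0 T := by
    rw [Set.univ_inter]
    exact Ioc_ae_eq_Icc.symm
  have f1 : ∫ θ in Set.univ, θ / M.Φ ∂M.typeLaw = T⁻¹ * (T ^ 2 / (2 * M.Φ)) := by
    rw [h.setIntegral_eq .univ, setIntegral_congr_set hI0]
    simpa using congrArg (T⁻¹ * ·) (integral_Ioc_sub_div (Φ := M.Φ) hT.le)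
  have f2 : ∫ θ in Set.univ, (θ / M.Φ) ^ 2 ∂M.typeLaw = T⁻¹ * (T ^ 3 / (3 * M.Φ ^ 2)) := by
    rw [h.setIntegral_eq .univ, setIntegral_congr_set hI0]
    simpa using congrArg (T⁻¹ * ·) (integral_Ioc_sub_div_sq (Φ := M.Φ) hT.le)
  have hK : (0 : ℝ) < M.K := Nat.cast_pos.2 h.K_pos
  rw [limitValue, poolValue, poolValue, e1, e2, f1, f2]
  field_simp

lemma LogUniform.ae_adsWatched_le (h : M.LogUniform T) (s : Scheme) {ω : ℝ} (hω : 0 ≤ ω) :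
    ∀ᵐ θ ∂M.typeLaw, M.adsWatched s θ ω ≤ T / M.Φ := by
  filter_upwards [h.ae_mem] with θ hθ
  refine (h.adsWatched_le s hω hθ.1.le).trans ?_
  have := h.Φ_pos
  gcongr
  exact hθ.2

lemma LogUniform.pool_watchers (h : M.LogUniform T) (s : Scheme) {ω : ℝ} (hω : 0 ≤ ω) :
    M.Pool (M.watchers s ω) fun θ => M.adsWatched s θ ω := by
  have := h.isProbabilityMeasure
  refine ⟨h.measurableSet_watchers s hω, fun θ hθ => hθ, ?_, ?_⟩
  · refine (Integrable.of_bound (h.measurable_adsWatched s hω).aestronglyMeasurable (T / M.Φ)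
      ?_).integrableOn
    filter_upwards [h.ae_adsWatched_le s hω] with θ hθ
    rwa [Real.norm_of_nonneg (h.adsWatched_nonneg s hω θ)]
  · refine (Integrable.of_bound
      ((h.measurable_adsWatched s hω).pow_const 2).aestronglyMeasurable ((T / M.Φ) ^ 2)
      ?_).integrableOn
    filter_upwards [h.ae_adsWatched_le s hω] with θ hθ
    rw [Real.norm_of_nonneg (sq_nonneg _)]
    exact pow_le_pow_left₀ (h.adsWatched_nonneg s hω θ) hθ 2

lemma LogUniform.dataRevenue_eq (h : M.LogUniform T) (s : Scheme) {ω : ℝ} (hω : 0 ≤ ω) :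
    M.dataRevenue s ω = M.N * M.F * M.typeLaw.real (M.subscribers ω s) := by
  rw [dataRevenue, h.subscription_eq s hω, integral_indicator_one
    (M.measurableSet_subscribers ω s)]

lemma LogUniform.dataRevenue_le (h : M.LogUniform T) (s : Scheme) {ω : ℝ} (hω : 0 ≤ ω) :
    M.dataRevenue s ω ≤ M.N * M.F := by
  have := h.isProbabilityMeasure
  rw [h.dataRevenue_eq s hω]
  exact mul_le_of_le_one_right (mul_pos h.N_pos h.F_pos).le measureReal_le_one

/-- Because ads are also open to non-subscribers, the gain from subscribing is at most `θ * log (1 +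
Q)` for every reward. Types for which this does not exceed the fee are lost. -/
lemma LogUniform.dataRevenue_SUR_le (h : M.LogUniform T) {ω : ℝ} (hω : 0 ≤ ω)
    (hT : M.F / Real.log (1 + M.Q) < T) :
    M.dataRevenue .SUR ω ≤ M.N * M.F * (T⁻¹ * (T - M.F / Real.log (1 + M.Q))) := by
  have hT0 := h.T_pos
  have hS := M.measurableSet_subscribers ω .SUR
  rw [h.dataRevenue_eq .SUR hω, ← integral_indicator_one hS, integral_indicator hS,
    h.setIntegral_eq hS]
  simp only [Pi.one_apply, integral_const, smul_eq_mul, mul_one, measureReal_restrict_apply_univ]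
  have hlog : 0 < Real.log (1 + M.Q) := Real.log_pos (by linarith [h.Q_pos])
  have hsub : M.subscribers ω .SUR ∩ Set.Icc 0 T ⊆ Set.Ioc (M.F / Real.log (1 + M.Q)) T := by
    rintro θ ⟨h1, h2⟩
    refine ⟨?_, h2.2⟩
    have h3 := logValue_sub_le h.Φ_pos h.Q_pos.le hω h2.1
    have h4 : logValue M.Φ 0 ω θ < logValue M.Φ M.Q ω θ - M.F := h1
    rw [div_lt_iff₀ hlog]
    linarith
  have := measureReal_mono (μ := volume) hsub (by simp)
  rw [Real.volume_real_Ioc_of_le hT.le] at this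
  have hNF := (mul_pos h.N_pos h.F_pos).le
  gcongr

/-- A crude bound, dropping the wear-out term, that serves only to make the suprema finite. -/
lemma LogUniform.poolValue_le (h : M.LogUniform T) (s : Scheme) {ω μ : ℝ} (hω : 0 ≤ ω)
    (hμ : μ ∈ Set.Icc (0 : ℝ) 1) :
    M.poolValue (M.watchers s ω) (fun θ => M.adsWatched s θ ω) μ ≤
      M.B * (M.N * (T / M.Φ)) := by
  have := h.isProbabilityMeasure
  have hN := h.N_pos
  have hB := h.B_pos
  have hA := h.A_nonneg
  have hb : 0 ≤ T / M.Φ := div_nonneg h.T_pos.le h.Φ_pos.le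
  have h1 : 0 ≤ ∫ θ in M.watchers s ω, M.adsWatched s θ ω ∂M.typeLaw :=
    integral_nonneg fun θ => h.adsWatched_nonneg s hω θ
  have h2 : 0 ≤ ∫ θ in M.watchers s ω, M.adsWatched s θ ω ^ 2 ∂M.typeLaw :=
    integral_nonneg fun θ => sq_nonneg _
  have h3 : ∫ θ in M.watchers s ω, M.adsWatched s θ ω ∂M.typeLaw ≤ T / M.Φ := by
    calc _ ≤ ∫ θ in M.watchers s ω, T / M.Φ ∂M.typeLaw :=
          integral_mono_ae (h.pool_watchers s hω).integrable (integrable_const _)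
            (ae_restrict_of_ae (h.ae_adsWatched_le s hω))
      _ = M.typeLaw.real (M.watchers s ω) * (T / M.Φ) := by
          rw [setIntegral_const, smul_eq_mul]
      _ ≤ T / M.Φ := mul_le_of_le_one_left hb measureReal_le_one
  unfold poolValue
  calc _ ≤ μ * (M.B * (M.N * ∫ θ in M.watchers s ω, M.adsWatched s θ ω ∂M.typeLaw)) :=
        sub_le_self _ (by positivity)
    _ ≤ M.B * (M.N * ∫ θ in M.watchers s ω, M.adsWatched s θ ω ∂M.typeLaw) :=
        mul_le_of_le_one_left (by positivity) hμ.2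
    _ ≤ _ := by gcongr

/-- The values of the two pools under the SUR scheme are rescalings of the limit value, by
factors whose sum is at most `1`. -/
lemma LogUniform.exists_poolValue_SUR_eq (h : M.LogUniform T) {ω : ℝ} (hω : 0 ≤ ω) :
    ∃ l₁ l₂ : ℝ, 0 ≤ l₁ ∧ 0 ≤ l₂ ∧ l₁ + l₂ ≤ 1 ∧
      (∀ μ, M.poolValue (M.subscribingWatchers .SUR ω) (fun θ => M.adsWatched .SUR θ ω) μ =
        l₁ * M.limitValue (l₁ * μ)) ∧
      (∀ μ, M.poolValue (M.nonsubscribingWatchers .SUR ω) (fun θ => M.adsWatched .SUR θ ω) μ =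
        l₂ * M.limitValue (l₂ * μ)) := by
  classical
  have hT := h.T_pos
  have hΦ := h.Φ_pos
  have hQ := h.Q_pos
  have hF := h.F_pos
  have hx := fun θ => congrFun (h.adsWatched_eq .SUR hω) θ
  have empty : ∀ {W : Set ℝ} {x : ℝ → ℝ} (μ : ℝ), W = ∅ →
      M.poolValue W x μ = 0 * M.limitValue (0 * μ) := by
    rintro W x μ rfl
    simp [poolValue]
  rcases hω.eq_or_lt with rfl | hω'
  · have hw : M.watchers .SUR 0 = ∅ := by
      ext θ
      simp only [watchers, hx, Set.piecewise, outsideAds, logAds, if_true]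
      simp
    refine ⟨0, 0, le_rfl, le_rfl, by norm_num, fun μ => empty μ ?_, fun μ => empty μ ?_⟩
    · rw [h.subscribingWatchers_eq .SUR le_rfl, hw, Set.empty_inter]
    · rw [h.nonsubscribingWatchers_eq .SUR le_rfl, hw, Set.empty_sdiff]
  set S := M.subscribers ω .SUR with hS
  have hSm : MeasurableSet S := M.measurableSet_subscribers ω .SUR
  set a₀ := M.Φ / ω with ha₀
  set a₁ := M.Φ * (1 + M.Q) / ω with ha₁
  have ha₀0 : 0 ≤ a₀ := by positivity
  have ha₁0 : 0 ≤ a₁ := by positivity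
  have ha₀₁ : a₀ ≤ a₁ := by
    rw [ha₀, ha₁]
    gcongr
    nlinarith
  have hW1 : M.subscribingWatchers .SUR ω = Set.Ioi a₁ ∩ S := by
    rw [h.subscribingWatchers_eq .SUR hω]
    ext θ
    simp only [Set.mem_inter_iff, watchers, Set.mem_ofPred_eq, hx, Set.mem_Ioi]
    refine and_congr_left fun hθ => ?_
    rw [Set.piecewise_eq_of_mem _ _ _ hθ, logAds_pos_iff hΦ hω']
  have hW2 : M.nonsubscribingWatchers .SUR ω = Set.Ioi a₀ \ S := by
    rw [h.nonsubscribingWatchers_eq .SUR hω]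
    ext θ
    simp only [Set.mem_sdiff, watchers, Set.mem_ofPred_eq, hx, Set.mem_Ioi]
    refine and_congr_left fun hθ => ?_
    rw [Set.piecewise_eq_of_notMem _ _ _ hθ, outsideAds, logAds_pos_iff hΦ hω', add_zero,
      mul_one]
  have hx1 : ∀ θ ∈ Set.Ioi a₁ ∩ S, M.adsWatched .SUR θ ω = (θ - a₁) / M.Φ := by
    rintro θ ⟨h1, h2⟩
    have := (logAds_pos_iff (q := M.Q) hΦ hω').2 h1
    rw [hx, Set.piecewise_eq_of_mem _ _ _ h2]
    rw [logAds_of_pos hω'] at this ⊢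
    rw [max_eq_right (lt_max_iff.1 this |>.resolve_left (lt_irrefl _)).le, ha₁]
    field_simp
  have hx2 : ∀ θ ∈ Set.Ioi a₀ \ S, M.adsWatched .SUR θ ω = (θ - a₀) / M.Φ := by
    rintro θ ⟨h1, h2⟩
    have h1' : M.Φ * (1 + 0) / ω < θ := by rw [add_zero, mul_one]; exact h1
    have := (logAds_pos_iff (q := 0) hΦ hω').2 h1'
    rw [hx, Set.piecewise_eq_of_notMem _ _ _ h2, outsideAds]
    rw [logAds_of_pos hω'] at this ⊢
    rw [max_eq_right (lt_max_iff.1 this |>.resolve_left (lt_irrefl _)).le, ha₀]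
    field_simp
    ring
  -- Above `a₁` the gain from subscribing is the constant `Φ Q / ω`, so these types subscribe all
  -- together or not at all.
  have hgain : ∀ θ, a₁ ≤ θ → (θ ∈ S ↔ M.F < M.Φ * M.Q / ω) := by
    intro θ hθ
    rw [← logValue_sub_eq hΦ hQ hω' hθ]
    simp only [hS, subscribers, Set.mem_ofPred_eq]
    constructor <;> intro <;> linarith
  obtain ⟨b, hab, hb, hmin⟩ := exists_inter_Icc_ae_eq_Ioc (W := Set.Ioi a₀ \ S) (T := T) ha₀0
    Set.sdiff_subset (by
      rintro θ hθ θ' ⟨-, h2⟩ hle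
      refine ⟨hθ, fun h3 => h2 ?_⟩
      have := logValue_sub_mono hΦ hQ hω' hθ hle
      simp only [hS, subscribers, Set.mem_ofPred_eq] at h3 ⊢
      linarith)
  have hbT : b ≤ max a₀ T := hmin _ (le_max_left _ _) fun θ _ h => h.trans (le_max_right _ _)
  have hbT' : b - a₀ ≤ T := by
    rcases le_max_iff.1 hbT with h | h <;> linarith
  have e2 : ∀ μ, M.poolValue (M.nonsubscribingWatchers .SUR ω)
      (fun θ => M.adsWatched .SUR θ ω) μ =
        (b - a₀) / T * M.limitValue ((b - a₀) / T * μ) := by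
    intro μ
    rw [hW2]
    exact h.poolValue_eq (measurableSet_Ioi.diff hSm) hab hb hx2 μ
  have hl2 : 0 ≤ (b - a₀) / T := div_nonneg (by linarith) hT.le
  by_cases hc : M.F < M.Φ * M.Q / ω
  · have hW1' : Set.Ioi a₁ ∩ S = Set.Ioi a₁ :=
      Set.inter_eq_left.2 fun θ hθ => (hgain θ (le_of_lt hθ)).2 hc
    -- All types above `a₁` subscribe, so the non-subscribing interval ends before the subscribing
    -- one begins.
    have hba : b ≤ a₁ := by
      refine hmin _ ha₀₁ fun θ hθ _ => ?_
      by_contra! hlt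
      exact hθ.2 ((hgain θ hlt.le).2 hc)
    have hI : (Set.Ioi a₁ ∩ Set.Icc 0 T : Set ℝ) = Set.Ioc a₁ (max a₁ T) := by
      ext θ
      simp only [Set.mem_inter_iff, Set.mem_Ioi, Set.mem_Icc, Set.mem_Ioc, le_max_iff]
      constructor
      · rintro ⟨h1, h2, h3⟩; exact ⟨h1, .inr h3⟩
      · rintro ⟨h1, h2⟩
        exact ⟨h1, by linarith, h2.resolve_left (not_le.2 h1)⟩
    refine ⟨(max a₁ T - a₁) / T, (b - a₀) / T,
      div_nonneg (sub_nonneg.2 (le_max_left _ _)) hT.le, hl2, ?_, fun μ => ?_, e2⟩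
    · rw [← add_div, div_le_one hT]
      rcases le_total a₁ T with h1 | h1
      · rw [max_eq_right h1]; linarith
      · rw [max_eq_left h1]; linarith
    · rw [hW1]
      exact h.poolValue_eq (measurableSet_Ioi.inter hSm) (le_max_left _ _)
        (by rw [hW1', hI]; exact ae_eq_refl _) hx1 μ
  · refine ⟨0, (b - a₀) / T, le_rfl, hl2, ?_, fun μ => empty μ ?_, e2⟩
    · rw [zero_add, div_le_one hT]
      exact hbT'
    · rw [hW1]
      ext θ
      simp only [Set.mem_inter_iff, Set.mem_Ioi, Set.mem_empty_iff_false, iff_false, not_and]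
      exact fun h1 h2 => hc ((hgain θ h1.le).1 h2)

/-- For large unit rewards, everybody subscribes under the SAR scheme, and the advertising
revenue approaches the limit value. -/
lemma LogUniform.tendsto_revenue_SAR (h : M.LogUniform T) (μ : ℝ) :
    Tendsto (fun ω => M.dataRevenue .SAR ω +
      M.poolValue (M.watchers .SAR ω) (fun θ => M.adsWatched .SAR θ ω) μ) atTop
      (𝓝 (M.N * M.F + M.limitValue μ)) := by
  classical
  have := h.isProbabilityMeasure
  have hsub : ∀ θ, 0 < θ → ∀ᶠ ω in atTop, θ ∈ M.subscribers ω .SAR := by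
    intro θ hθ
    filter_upwards [(tendsto_logValue h.Φ_pos h.Q_pos.le hθ).eventually_gt_atTop M.F] with ω hω
    simpa only [subscribers, Set.mem_ofPred_eq, sub_pos] using hω
  have hads : ∀ θ, 0 < θ →
      Tendsto (fun ω => M.adsWatched .SAR θ ω) atTop (𝓝 (θ / M.Φ)) := by
    intro θ hθ
    refine (tendsto_logAds (q := M.Q) h.Φ_pos hθ).congr' ?_
    filter_upwards [hsub θ hθ, eventually_ge_atTop 0] with ω h1 h2
    rw [congrFun (h.adsWatched_eq .SAR h2) θ, Set.piecewise_eq_of_mem _ _ _ h1]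
  have t0 : Tendsto (fun ω => ∫ θ, M.subscription .SAR θ ω ∂M.typeLaw) atTop (𝓝 1) := by
    have : ∫ _, (1 : ℝ) ∂M.typeLaw = 1 := by simp
    rw [← this]
    refine tendsto_integral_filter_of_dominated_convergence (fun _ => 1) ?_ ?_
      (integrable_const _) ?_
    · filter_upwards [eventually_ge_atTop 0] with ω hω
      rw [h.subscription_eq .SAR hω]
      exact (measurable_one.indicator (M.measurableSet_subscribers ω .SAR)).aestronglyMeasurable
    · filter_upwards [eventually_ge_atTop 0] with ω hω
      refine ae_of_all _ fun θ => ?_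
      rw [congrFun (h.subscription_eq .SAR hω) θ, Set.indicator_apply]
      split_ifs <;> simp
    · filter_upwards [h.ae_mem] with θ hθ
      refine tendsto_const_nhds.congr' ?_
      filter_upwards [hsub θ hθ.1, eventually_ge_atTop 0] with ω h1 h2
      exact ((h.subscription_eq_one_iff .SAR h2 θ).2 h1).symm
  have tp : ∀ k : ℕ, k ≠ 0 → Tendsto (fun ω => ∫ θ in M.watchers .SAR ω,
      M.adsWatched .SAR θ ω ^ k ∂M.typeLaw) atTop
      (𝓝 (∫ θ in Set.univ, (θ / M.Φ) ^ k ∂M.typeLaw)) := by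
    -- Types outside the watchers contribute `0 ^ k = 0`, so the moving domain can be replaced by
    -- all types before dominated convergence.
    intro k hk
    have e : (fun ω => ∫ θ, M.adsWatched .SAR θ ω ^ k ∂M.typeLaw) =ᶠ[atTop]
        fun ω => ∫ θ in M.watchers .SAR ω, M.adsWatched .SAR θ ω ^ k ∂M.typeLaw := by
      filter_upwards [eventually_ge_atTop 0] with ω hω
      refine (setIntegral_eq_integral_of_forall_compl_eq_zero fun θ hθ => ?_).symm
      have h1 : ¬ 0 < M.adsWatched .SAR θ ω := hθ
      rw [le_antisymm (not_lt.1 h1) (h.adsWatched_nonneg .SAR hω θ), zero_pow hk]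
    rw [setIntegral_univ]
    refine Tendsto.congr' e ?_
    refine tendsto_integral_filter_of_dominated_convergence (fun _ => (T / M.Φ) ^ k) ?_ ?_
      (integrable_const _) ?_
    · filter_upwards [eventually_ge_atTop 0] with ω hω
      exact ((h.measurable_adsWatched .SAR hω).pow_const k).aestronglyMeasurable
    · filter_upwards [eventually_ge_atTop 0] with ω hω
      filter_upwards [h.ae_adsWatched_le .SAR hω] with θ hθ
      have h0 := h.adsWatched_nonneg .SAR hω θ
      rw [Real.norm_of_nonneg (pow_nonneg h0 k)]
      exact pow_le_pow_left₀ h0 hθ k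
    · filter_upwards [h.ae_mem] with θ hθ
      exact (hads θ hθ.1).pow k
  have t1 := tp 1 one_ne_zero
  have t2 := tp 2 two_ne_zero
  simp only [pow_one] at t1
  have t3 := (t0.const_mul (M.N * M.F)).add
    ((((t1.const_mul M.N).const_mul M.B).const_mul μ).sub
      (((t2.const_mul M.N).const_mul (2 * M.A / M.K)).const_mul (μ ^ 2)))
  rw [mul_one] at t3
  exact t3

end Market

/-! ### Optimal revenues as the capacity grows -/

lemma tendsto_csSup_of_monotone {S : ℝ → Set ℝ} (hS : Monotone S)
    (hb : BddAbove (⋃ C, S C)) (hne : (⋃ C, S C).Nonempty) :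
    Tendsto (fun C => sSup (S C)) atTop (𝓝 (sSup (⋃ C, S C))) := by
  obtain ⟨R₀, hR₀⟩ := hne
  obtain ⟨C₀, hC₀⟩ := Set.mem_iUnion.1 hR₀
  have hbC : ∀ C, BddAbove (S C) := fun C => hb.mono (Set.subset_iUnion S C)
  rw [tendsto_order]
  constructor
  · intro a ha
    obtain ⟨R, hR, haR⟩ := exists_lt_of_lt_csSup ⟨R₀, hR₀⟩ ha
    obtain ⟨C₁, hC₁⟩ := Set.mem_iUnion.1 hR
    filter_upwards [eventually_ge_atTop C₁] with C hC
    exact haR.trans_le (le_csSup (hbC C) (hS hC hC₁))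
  · intro a ha
    -- Below `C₀` the set may be empty, and its real supremum would be the default `0`.
    filter_upwards [eventually_ge_atTop C₀] with C hC
    exact (csSup_le_csSup hb ⟨R₀, hS hC hC₀⟩ (Set.subset_iUnion S C)).trans_lt ha

namespace Market

variable {M : Market} {T : ℝ}

lemma revenues_mono (s : Scheme) : Monotone (M.revenues s) := by
  rintro C C' hC R ⟨ω, p, m, hω, hD, h⟩
  exact ⟨ω, p, m, hω, hD.trans hC, h⟩

lemma revenuesDiff_mono : Monotone M.revenuesDiff := by
  rintro C C' hC R ⟨ω, p₁, p₂, m₁, m₂, hω, hD, h⟩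
  exact ⟨ω, p₁, p₂, m₁, m₂, hω, hD.trans hC, h⟩

lemma LogUniform.pool_subscribingWatchers (h : M.LogUniform T) (s : Scheme) {ω : ℝ}
    (hω : 0 ≤ ω) : M.Pool (M.subscribingWatchers s ω) fun θ => M.adsWatched s θ ω := by
  rw [h.subscribingWatchers_eq s hω]
  exact (h.pool_watchers s hω).inter (M.measurableSet_subscribers ω s)

lemma LogUniform.pool_nonsubscribingWatchers (h : M.LogUniform T) (s : Scheme) {ω : ℝ}
    (hω : 0 ≤ ω) : M.Pool (M.nonsubscribingWatchers s ω) fun θ => M.adsWatched s θ ω := by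
  rw [h.nonsubscribingWatchers_eq s hω]
  exact (h.pool_watchers s hω).sdiff (M.measurableSet_subscribers ω s)

lemma LogUniform.dataDemand_zero (h : M.LogUniform T) :
    M.dataDemand .SUR 0 = M.dataDemand .SAR 0 := by
  have hS : M.subscribers 0 .SUR = M.subscribers 0 .SAR := by
    ext θ
    simp [subscribers, logValue, logAds]
  have e : (fun θ => M.subscription .SUR θ 0) = fun θ => M.subscription .SAR θ 0 := by
    rw [h.subscription_eq .SUR le_rfl, h.subscription_eq .SAR le_rfl, hS]
  unfold dataDemand
  simp only [zero_mul, add_zero]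
  simp_rw [fun θ => congrFun e θ]

lemma LogUniform.exists_mem_revenues (h : M.LogUniform T) {s : Scheme} {ω C μ : ℝ}
    (hω : 0 ≤ ω) (hD : M.dataDemand s ω ≤ C) (hμ : μ ∈ Set.Icc (0 : ℝ) 1) :
    ∃ R ∈ M.revenues s C, M.dataRevenue s ω +
      M.poolValue (M.watchers s ω) (fun θ => M.adsWatched s θ ω) μ ≤ R := by
  obtain ⟨p, m, hs, hle⟩ := (h.pool_watchers s hω).exists_feasibleSale h.toAdMarket hμ
  exact ⟨_, ⟨ω, p, m, hω, hD, hs, rfl⟩, by linarith⟩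

/-- Selling the same fraction `μ` in both pools earns the value of the joint pool, by additivity. -/
lemma LogUniform.exists_mem_revenuesDiff (h : M.LogUniform T) {ω C μ : ℝ}
    (hω : 0 ≤ ω) (hD : M.dataDemand .SUR ω ≤ C) (hμ : μ ∈ Set.Icc (0 : ℝ) 1) :
    ∃ R ∈ M.revenuesDiff C, M.dataRevenue .SUR ω +
      M.poolValue (M.watchers .SUR ω) (fun θ => M.adsWatched .SUR θ ω) μ ≤ R := by
  obtain ⟨p₁, m₁, hs₁, hle₁⟩ :=
    (h.pool_subscribingWatchers .SUR hω).exists_feasibleSale h.toAdMarket hμ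
  obtain ⟨p₂, m₂, hs₂, hle₂⟩ :=
    (h.pool_nonsubscribingWatchers .SUR hω).exists_feasibleSale h.toAdMarket hμ
  refine ⟨_, ⟨ω, p₁, p₂, m₁, m₂, hω, hD, hs₁, hs₂, rfl⟩, ?_⟩
  have := poolValue_inter_add_sdiff (h.pool_watchers .SUR hω)
    (M.measurableSet_subscribers ω .SUR) μ
  rw [h.subscribingWatchers_eq .SUR hω] at hle₁
  rw [h.nonsubscribingWatchers_eq .SUR hω] at hle₂
  linarith

lemma LogUniform.revenues_nonempty (h : M.LogUniform T) (s : Scheme) {C : ℝ}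
    (hC : M.dataDemand .SAR 0 ≤ C) : (M.revenues s C).Nonempty := by
  have hD : M.dataDemand s 0 ≤ C := by
    cases s
    · exact hC
    · rwa [h.dataDemand_zero]
  obtain ⟨R, hR, -⟩ := h.exists_mem_revenues le_rfl hD (Set.left_mem_Icc.2 zero_le_one)
  exact ⟨R, hR⟩

lemma LogUniform.revenuesDiff_nonempty (h : M.LogUniform T) {C : ℝ}
    (hC : M.dataDemand .SAR 0 ≤ C) : (M.revenuesDiff C).Nonempty := by
  obtain ⟨R, hR, -⟩ := h.exists_mem_revenuesDiff le_rfl (h.dataDemand_zero.trans_le hC)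
    (Set.left_mem_Icc.2 zero_le_one)
  exact ⟨R, hR⟩

lemma LogUniform.bddAbove_revenues (h : M.LogUniform T) (s : Scheme) :
    BddAbove (⋃ C, M.revenues s C) := by
  refine ⟨M.N * M.F + M.B * (M.N * (T / M.Φ)), ?_⟩
  intro R hR
  obtain ⟨C, ω, p, m, hω, -, hs, rfl⟩ := Set.mem_iUnion.1 hR
  obtain ⟨μ, hμ, hv⟩ := hs.exists_poolValue_eq h.toAdMarket (h.pool_watchers s hω)
  rw [hv]
  exact add_le_add (h.dataRevenue_le s hω) (h.poolValue_le s hω hμ)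

/-- Every revenue under the SUR scheme with differentiation is smaller, by at least the
forgone subscriptions of the low types, than the limit revenue under the SAR scheme. -/
lemma LogUniform.revenuesDiff_le (h : M.LogUniform T) (hT : M.F / Real.log (1 + M.Q) < T)
    {g : ℝ} (hg : ∀ μ ∈ Set.Icc (0 : ℝ) 1, M.limitValue μ ≤ g) {R : ℝ}
    (hR : R ∈ ⋃ C, M.revenuesDiff C) :
    R ≤ M.N * M.F * (T⁻¹ * (T - M.F / Real.log (1 + M.Q))) + g := by
  obtain ⟨C, ω, p₁, p₂, m₁, m₂, hω, -, hs₁, hs₂, rfl⟩ := Set.mem_iUnion.1 hR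
  obtain ⟨μ₁, hμ₁, hv₁⟩ :=
    hs₁.exists_poolValue_eq h.toAdMarket (h.pool_subscribingWatchers .SUR hω)
  obtain ⟨μ₂, hμ₂, hv₂⟩ :=
    hs₂.exists_poolValue_eq h.toAdMarket (h.pool_nonsubscribingWatchers .SUR hω)
  obtain ⟨l₁, l₂, hl₁, hl₂, hl, e₁, e₂⟩ := h.exists_poolValue_SUR_eq hω
  rw [hv₁, hv₂, e₁, e₂]
  have hg0 : 0 ≤ g := by
    simpa [limitValue, poolValue] using hg 0 (Set.left_mem_Icc.2 zero_le_one)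
  have key : ∀ l μ : ℝ, 0 ≤ l → l ≤ 1 → μ ∈ Set.Icc (0 : ℝ) 1 →
      l * M.limitValue (l * μ) ≤ l * g := fun l μ h0 h1 hμ =>
    mul_le_mul_of_nonneg_left
      (hg _ ⟨mul_nonneg h0 hμ.1, mul_le_one₀ h1 hμ.1 hμ.2⟩) h0
  have k₁ := key l₁ μ₁ hl₁ (by linarith) hμ₁
  have k₂ := key l₂ μ₂ hl₂ (by linarith) hμ₂
  have k := mul_le_mul_of_nonneg_right hl hg0
  have := h.dataRevenue_SUR_le hω hT
  linarith

/-- With all capacities allowed, each `ω ≥ 0` is admissible: take the capacity equal to its demand.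
The bound then passes to the limit. -/
lemma LogUniform.le_sSup_revenues_SAR (h : M.LogUniform T) {μ : ℝ}
    (hμ : μ ∈ Set.Icc (0 : ℝ) 1) :
    M.N * M.F + M.limitValue μ ≤ sSup (⋃ C, M.revenues .SAR C) := by
  refine le_of_tendsto (h.tendsto_revenue_SAR μ) ?_
  filter_upwards [eventually_ge_atTop 0] with ω hω
  obtain ⟨R, hR, hle⟩ := h.exists_mem_revenues (s := .SAR) hω le_rfl hμ
  exact hle.trans (le_csSup (h.bddAbove_revenues .SAR) (Set.mem_iUnion.2 ⟨_, hR⟩))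

lemma exists_isMaxOn_limitValue (M : Market) :
    ∃ μ ∈ Set.Icc (0 : ℝ) 1, ∀ ν ∈ Set.Icc (0 : ℝ) 1, M.limitValue ν ≤ M.limitValue μ := by
  have hc : ContinuousOn M.limitValue (Set.Icc 0 1) := by
    unfold limitValue poolValue
    fun_prop
  obtain ⟨μ, hμ, hmax⟩ := isCompact_Icc.exists_isMaxOn (Set.nonempty_Icc.2 zero_le_one) hc
  exact ⟨μ, hμ, fun ν hν => hmax hν⟩

lemma LogUniform.optSUR_le_optSURD (h : M.LogUniform T) {C : ℝ}
    (hC : M.dataDemand .SAR 0 ≤ C) (hb : BddAbove (M.revenuesDiff C)) :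
    M.optSUR C ≤ M.optSURD C := by
  refine csSup_le (h.revenues_nonempty .SUR hC) ?_
  rintro R ⟨ω, p, m, hω, hD, hs, rfl⟩
  obtain ⟨μ, hμ, hv⟩ := hs.exists_poolValue_eq h.toAdMarket (h.pool_watchers .SUR hω)
  obtain ⟨R, hR, hle⟩ := h.exists_mem_revenuesDiff hω hD hμ
  rw [hv]
  exact hle.trans (le_csSup hb hR)

end Market

lemma logUniform_logUniformMarket {N F Q Φ A B θmax : ℝ} {K : ℕ}
    (hN : 0 < N) (hF : 0 < F) (hQ : 0 < Q) (hΦ : 0 < Φ) (hK : 0 < K) (hA : 0 ≤ A) (hB : 0 < B)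
    (hθ : 0 < θmax) : (logUniformMarket N F Q Φ K A B θmax).LogUniform θmax where
  u_eq := rfl
  F_pos := hF
  Q_pos := hQ
  Φ_pos := hΦ
  N_pos := hN
  A_nonneg := hA
  B_pos := hB
  K_pos := hK
  isProbabilityMeasure := by
    refine cond_isProbabilityMeasure_of_finite ?_ ?_ <;> simp [hθ]
  T_pos := hθ
  typeLaw_eq := rfl

end

/-- The hypothesis `hθ` is the standing assumption `u'(0) F / (u'(Q) u(Q)) < θmax` for
`u(z) = ln (1 + z)`. The first conjunct says that the three optimal revenues are genuine
(finite) suprema whenever the capacity covers the demand without rewards. -/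
theorem theorem5 (N F Q Φ A B θmax : ℝ) (K : ℕ)
    (hN : 0 < N) (hF : 0 < F) (hQ : 0 < Q) (hΦ : 0 < Φ) (hK : 0 < K) (hA : 0 ≤ A) (hB : 0 < B)
    (hθ : (1 + Q) * F / Real.log (1 + Q) < θmax)
    (M : Market) (hM : M = logUniformMarket N F Q Φ K A B θmax) :
    (∀ C : ℝ, M.dataDemand .SAR 0 ≤ C →
      IsLUB (M.revenues .SAR C) (M.optSAR C) ∧
      IsLUB (M.revenuesDiff C) (M.optSURD C) ∧
      IsLUB (M.revenues .SUR C) (M.optSUR C)) ∧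
    (∀ᶠ C : ℝ in atTop, M.optSAR C > M.optSURD C ∧ M.optSURD C ≥ M.optSUR C) ∧
    (∃ LSAR LSURD LSUR : ℝ,
      Tendsto M.optSAR atTop (𝓝 LSAR) ∧
      Tendsto M.optSURD atTop (𝓝 LSURD) ∧
      Tendsto M.optSUR atTop (𝓝 LSUR) ∧
      LSAR > LSURD ∧ LSURD ≥ LSUR) := by
  have hlog : 0 < Real.log (1 + Q) := Real.log_pos (by linarith)
  have hc : 0 < F / Real.log (1 + Q) := div_pos hF hlog
  -- Only this weaker consequence of `hθ` is needed; the factor `1 + Q` exceeds `1`.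
  have hcT : F / Real.log (1 + Q) < θmax := by
    refine lt_trans ?_ hθ
    rw [mul_div_assoc]
    nlinarith
  have hT : 0 < θmax := hc.trans hcT
  have h : M.LogUniform θmax := by
    rw [hM]
    exact logUniform_logUniformMarket hN hF hQ hΦ hK hA hB hT
  have hcT' : M.F / Real.log (1 + M.Q) < θmax := by rw [hM]; exact hcT
  have hc' : 0 < M.F / Real.log (1 + M.Q) := by rw [hM]; exact hc
  obtain ⟨μ, hμ, hmax⟩ := M.exists_isMaxOn_limitValue
  have hbD : BddAbove (⋃ C, M.revenuesDiff C) := ⟨_, fun _ hR => h.revenuesDiff_le hcT' hmax hR⟩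
  have hneD : (⋃ C, M.revenuesDiff C).Nonempty :=
    (h.revenuesDiff_nonempty le_rfl).mono (Set.subset_iUnion M.revenuesDiff _)
  have hne : ∀ s, (⋃ C, M.revenues s C).Nonempty := fun s =>
    (h.revenues_nonempty s le_rfl).mono (Set.subset_iUnion (M.revenues s) _)
  have hbDC : ∀ C, BddAbove (M.revenuesDiff C) := fun C =>
    hbD.mono (Set.subset_iUnion M.revenuesDiff C)
  have hbC : ∀ s C, BddAbove (M.revenues s C) := fun s C =>
    (h.bddAbove_revenues s).mono (Set.subset_iUnion (M.revenues s) C)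
  have tSAR : Tendsto M.optSAR atTop (𝓝 _) := tendsto_csSup_of_monotone (Market.revenues_mono .SAR)
    (h.bddAbove_revenues .SAR) (hne .SAR)
  have tSUR : Tendsto M.optSUR atTop (𝓝 _) := tendsto_csSup_of_monotone (Market.revenues_mono .SUR)
    (h.bddAbove_revenues .SUR) (hne .SUR)
  have tSURD : Tendsto M.optSURD atTop (𝓝 _) :=
    tendsto_csSup_of_monotone Market.revenuesDiff_mono hbD hneD
  -- The gap is at least `N F` times the share `F / (θmax log (1 + Q))` of types that never
  -- subscribe under SUR.
  have hgt : sSup (⋃ C, M.revenuesDiff C) < sSup (⋃ C, M.revenues .SAR C) := by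
    refine (csSup_le hneD fun R hR => h.revenuesDiff_le hcT' hmax hR).trans_lt
      (lt_of_lt_of_le ?_ (h.le_sSup_revenues_SAR hμ))
    have hNF := mul_pos h.N_pos h.F_pos
    have h1 : θmax⁻¹ * (θmax - M.F / Real.log (1 + M.Q)) < 1 := by
      rw [inv_mul_lt_one₀ hT]
      linarith
    have := mul_lt_mul_of_pos_left h1 hNF
    linarith
  have hge : ∀ᶠ C in atTop, M.optSUR C ≤ M.optSURD C := by
    filter_upwards [eventually_ge_atTop (M.dataDemand .SAR 0)] with C hC
    exact h.optSUR_le_optSURD hC (hbDC C)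
  refine ⟨fun C hC => ⟨isLUB_csSup (h.revenues_nonempty .SAR hC) (hbC .SAR C),
    isLUB_csSup (h.revenuesDiff_nonempty hC) (hbDC C),
    isLUB_csSup (h.revenues_nonempty .SUR hC) (hbC .SUR C)⟩, ?_,
    _, _, _, tSAR, tSURD, tSUR, hgt, le_of_tendsto_of_tendsto tSUR tSURD hge⟩
  filter_upwards [tSURD.eventually_lt tSAR hgt, hge] with C h1 h2
  exact ⟨h1, h2⟩
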